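/- Let $\mathcal X,\mathcal Y$ be measurable spaces, $\mathcal Z=\mathcal X\times\mathcal Y$, and $\tilde{\mathcal Z}=\mathcal Z\cup\mathcal Z^2\cup\mathcal Z^3\cup\cdots$. Let $P_X$ be a probability distribution on $\mathcal X$, and let $P_{N|X}$, $P_{Y|X}$ be Markov kernels from $\mathcal X$ to $\{1,2,\dots\}$ and to $\mathcal Y$, with $\mathbb P(N\ge 2)>0$ for $(X,N)\sim P_X\times P_{N|X}$. Let $P_X^{\ge 2}$ be the conditional distribution of $X$ given $N\ge 2$. Training data: $\mathcal D=(\tilde Z_1,\dots,\tilde Z_K)$ consists of $K$ independent groups $\tilde Z_k=(Z_{k,1},\dots,Z_{k,N_k})$, $Z_{k,i}=(X_k,Y_{k,i})$, where $X_k\sim P_X$, $N_k\mid X_k\sim P_{N|X}$, and $Y_{k,1},\dots,Y_{k,N_k}\mid (X_k,N_k)$ are i.i.d. from $P_{Y|X}$ at $X=X_k$. Let $\mathcal A$ map $(K+1)$-tuples of elements of $\tilde{\mathcal Z}$ to functions $\mathcal Z\to\mathbb R$, such that $(\tilde z_1,\dots,\tilde z_{K+1},z)\mapsto \mathcal A(\tilde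 z_1,\dots,\tilde z_{K+1})(z)$ is measurable, and suppose that $\mathcal A$ is hierarchically symmetric: its output does not change when the $K+1$ groups are permuted, nor when the entries within any one group are permuted. Let $\alpha\in[0,1]$. For $\tilde z\in\tilde{\mathcal Z}$ put $s^{\tilde z}=\mathcal A(\tilde Z_1,\dots,\tilde Z_K,\tilde z)$, let $P_1\tilde z$ be the first entry of $\tilde z$, let $K^{\ge2}=\#\{k\le K: N_k\ge2\}$, and let $$\tilde C=\Big\{\tilde z\in\tilde{\mathcal Z}: s^{\tilde z}(P_1\tilde z)\le Q_{1-\alpha^2}\Big(\sum_{k\le K,\,N_k\ge2}\ \sum_{1\le i<i'\le N_k}\frac{1}{(K^{\ge2}+1)\binom{N_k}{2}}\,\delta_{\min\{s^{\tilde z}(Z_{k,i}),\,s^{\tilde z}(Z_{k,i'})\}}+\frac1{K^{\ge2}+1}\,\delta_{+\infty}\Big)\Big\},$$ where $Q_\tau(P)=\inf\{t\in\mathbb R:\mathbb P_{T\sim P}(T\le t)\ge\tau\}\in[-\infty,+\infty]$. Define the prediction set $\widehat C(x)=\{y\in\mathcal Y:(x,y)=P_1\tilde z\text{ for some }\tilde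 z\in\tilde C\}$ and the conditional miscoverage rate $\alpha_{\mathcal D}(x)=\mathbb P(Y_{\rm test}\notin\widehat C(x)\mid\mathcal D;\,X_{\rm test}=x)$, where $Y_{\rm test}\sim P_{Y|X}$ at $X=x$, independently of $\mathcal D$. Then, for $X_{\rm test}\sim P_X^{\ge2}$ drawn independently of $\mathcal D$, with the expectation taken over both $\mathcal D$ and $X_{\rm test}$, $$\mathbb E_{P_X^{\ge2}}\big[\alpha_{\mathcal D}(X_{\rm test})^2\big]\le\alpha^2 .$$ (Where the event $Y_{\rm test}\notin\widehat C(x)$ or the function $\alpha_{\mathcal D}(x)$ is not measurable, the probability is read as outer probability and the expectation as upper expectation, i.e. the infimum of the expectations of measurable majorants.) -/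

import Mathlib

open MeasureTheory ProbabilityTheory

/-- The group sizes `1, 2, 3, …` carry the discrete sigma-algebra. -/
instance instMeasurableSpaceGroupSize : MeasurableSpace ℕ+ := ⊤

instance instDiscreteMeasurableSpaceGroupSize : DiscreteMeasurableSpace ℕ+ := ⟨fun _ => trivial⟩

/-- The space `𝒵 ∪ 𝒵² ∪ 𝒵³ ∪ …` of nonempty finite sequences ("groups") of data points `(x, y)`.
Its sigma-algebra is Mathlib's sigma-algebra of a disjoint union, with the product sigma-algebra
on each `𝒵ⁿ`. -/
abbrev DataGroup (𝓧 𝓨 : Type*) : Type _ := Σ n : ℕ+, (Fin (n : ℕ) → 𝓧 × 𝓨)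

namespace DataGroup

variable {𝓧 𝓨 : Type*}

/-- The projection to the first entry of a group. -/
def head (z : DataGroup 𝓧 𝓨) : 𝓧 × 𝓨 := z.2 ⟨0, z.1.pos⟩

/-- Reordering the entries of a group. -/
def permute (z : DataGroup 𝓧 𝓨) (σ : Equiv.Perm (Fin (z.1 : ℕ))) : DataGroup 𝓧 𝓨 := ⟨z.1, z.2 ∘ σ⟩

/-- The group with feature `x` and responses `y 0, …, y (n - 1)`. -/
def ofResponses (n : ℕ+) (x : 𝓧) (y : Fin (n : ℕ) → 𝓨) : DataGroup 𝓧 𝓨 := ⟨n, fun i => (x, y i)⟩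

end DataGroup

section Model

variable {𝓧 𝓨 : Type*} [MeasurableSpace 𝓧] [MeasurableSpace 𝓨]

theorem measurable_group_ofResponses (n : ℕ+) :
    Measurable fun p : 𝓧 × (Fin (n : ℕ) → 𝓨) => DataGroup.ofResponses n p.1 p.2 := by
  have h : Measurable fun p : 𝓧 × (Fin (n : ℕ) → 𝓨) => fun i => (p.1, p.2 i) := by
    fun_prop
  have h2 : Measurable fun z : Fin (n : ℕ) → 𝓧 × 𝓨 => (⟨n, z⟩ : DataGroup 𝓧 𝓨) :=
    fun s hs => MeasurableSpace.measurableSet_iInf.1 hs n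
  exact h2.comp h

theorem measurable_pi_const_kernel (PY : Kernel 𝓧 𝓨) [IsMarkovKernel PY] (n : ℕ) :
    Measurable fun x => Measure.pi fun _ : Fin n => PY x := by
  refine Measurable.measure_of_isPiSystem_of_isProbabilityMeasure generateFrom_pi.symm
    isPiSystem_pi ?_
  rintro s ⟨t, ht, rfl⟩
  simp only [Measure.pi_pi]
  exact Finset.measurable_prod _ fun i _ => PY.measurable_coe (ht i trivial)

theorem measurable_groupKernel (PY : Kernel 𝓧 𝓨) [IsMarkovKernel PY] :
    Measurable fun p : 𝓧 × ℕ+ =>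
      (Measure.pi fun _ : Fin (p.2 : ℕ) => PY p.1).map (DataGroup.ofResponses p.2 p.1) := by
  refine measurable_from_prod_countable_left fun n => ?_
  refine Measure.measurable_of_measurable_coe _ fun s hs => ?_
  have : IsMarkovKernel (⟨_, measurable_pi_const_kernel PY n⟩ : Kernel 𝓧 (Fin (n : ℕ) → 𝓨)) :=
    ⟨fun x => inferInstanceAs (IsProbabilityMeasure (Measure.pi fun _ => PY x))⟩
  have key := Kernel.measurable_kernel_prodMk_left
    (κ := (⟨_, measurable_pi_const_kernel PY n⟩ : Kernel 𝓧 (Fin (n : ℕ) → 𝓨)))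
    (measurable_group_ofResponses (𝓧 := 𝓧) (𝓨 := 𝓨) n hs)
  convert key using 2 with x
  exact Measure.map_apply ((measurable_group_ofResponses n).comp measurable_prodMk_left) hs

/-- Given the feature `x` and the size `n`, the law of the group `((x, Y₁), …, (x, Yₙ))` where
`Y₁, …, Yₙ` are i.i.d. with law `PY x`. -/
noncomputable def groupKernel (PY : Kernel 𝓧 𝓨) [IsMarkovKernel PY] :
    Kernel (𝓧 × ℕ+) (DataGroup 𝓧 𝓨) where
  toFun p := (Measure.pi fun _ : Fin (p.2 : ℕ) => PY p.1).map (DataGroup.ofResponses p.2 p.1)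
  measurable' := measurable_groupKernel PY

/-- The law of one group `(Z₁, …, Z_N)`, `Zᵢ = (X, Yᵢ)`, of repeated measurements: `X ∼ PX`,
`N | X ∼ PN X` and `Y₁, …, Y_N | (X, N)` i.i.d. with law `PY X`. -/
noncomputable def groupLaw (PX : Measure 𝓧) (PN : Kernel 𝓧 ℕ+) (PY : Kernel 𝓧 𝓨)
    [IsMarkovKernel PY] : Measure (DataGroup 𝓧 𝓨) :=
  groupKernel PY ∘ₘ (PX ⊗ₘ PN)

/-- The law of the training data: `K` independent groups of repeated measurements. -/
noncomputable def trainingLaw (K : ℕ) (PX : Measure 𝓧) (PN : Kernel 𝓧 ℕ+) (PY : Kernel 𝓧 𝓨)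
    [IsMarkovKernel PY] : Measure (Fin K → DataGroup 𝓧 𝓨) :=
  Measure.pi fun _ => groupLaw PX PN PY

/-- The conditional law of `X` given `N ≥ 2`, where `(X, N) ∼ PX × PN`. -/
noncomputable def featureLawTwo (PX : Measure 𝓧) (PN : Kernel 𝓧 ℕ+) : Measure 𝓧 :=
  ((PX ⊗ₘ PN)[|{p : 𝓧 × ℕ+ | 2 ≤ p.2}]).map Prod.fst

end Model

/-- The upper expectation of a function with values in `[0, ∞]` that need not be measurable: the
infimum of the expectations of its measurable majorants. -/
noncomputable def upperExpectation {Ω : Type*} [MeasurableSpace Ω] (μ : Measure Ω)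
    (f : Ω → ENNReal) : ENNReal :=
  ⨅ (g : Ω → ENNReal) (_ : Measurable g) (_ : f ≤ g), ∫⁻ ω, g ω ∂μ

/-- For almost everywhere measurable functions the upper expectation is the expectation. -/
theorem upperExpectation_eq_lintegral {Ω : Type*} [MeasurableSpace Ω] {μ : Measure Ω}
    {f : Ω → ENNReal} (hf : AEMeasurable f μ) : upperExpectation μ f = ∫⁻ ω, f ω ∂μ := by
  classical
  refine le_antisymm ?_ (le_iInf fun g => le_iInf fun _ => le_iInf fun h => lintegral_mono h)
  set s := toMeasurable μ {ω | ¬ f ω = hf.mk f ω} with hs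
  have hs0 : μ s = 0 := by rw [hs, measure_toMeasurable]; exact hf.ae_eq_mk
  have hg : Measurable (s.piecewise (fun _ => ⊤) (hf.mk f)) :=
    measurable_const.piecewise (measurableSet_toMeasurable _ _) hf.measurable_mk
  refine (iInf₂_le_of_le _ hg (iInf_le _ fun ω => ?_)).trans (lintegral_congr_ae ?_).le
  · by_cases h : ω ∈ s
    · simp [h]
    · have h2 : f ω = hf.mk f ω := by
        by_contra h3
        exact h (subset_toMeasurable _ _ h3)
      simp [h, h2]
  · filter_upwards [measure_eq_zero_iff_ae_notMem.1 hs0, hf.ae_eq_mk] with ω h h2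
    simp [h, h2]

section Method

variable {𝓧 𝓨 : Type*}

/-- An algorithm that maps `K + 1` groups to a score function is hierarchically symmetric if its
output does not change when the groups are permuted, nor when the entries of one of the groups
are permuted. -/
structure IsHierarchicallySymmetric {K : ℕ}
    (A : (Fin (K + 1) → DataGroup 𝓧 𝓨) → 𝓧 × 𝓨 → ℝ) : Prop where
  perm_groups : ∀ (z : Fin (K + 1) → DataGroup 𝓧 𝓨) (σ : Equiv.Perm (Fin (K + 1))),
    A (z ∘ σ) = A z
  perm_within : ∀ (z : Fin (K + 1) → DataGroup 𝓧 𝓨) (k : Fin (K + 1))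
    (σ : Equiv.Perm (Fin ((z k).1 : ℕ))), A (Function.update z k ((z k).permute σ)) = A z

/-- The quantile `inf {t ∈ ℝ : P(T ≤ t) ≥ τ}` of a distribution on the extended real line; the
infimum of the empty set is `+∞`. -/
noncomputable def quantile (τ : ℝ) (P : Measure EReal) : EReal :=
  sInf ((fun t : ℝ => (t : EReal)) '' {t : ℝ | τ ≤ P.real (Set.Iic (t : EReal))})

/-- The number of groups with at least two entries. -/
def numGroupsTwo {K : ℕ} (D : Fin K → DataGroup 𝓧 𝓨) : ℕ :=
  (Finset.univ.filter fun k => 2 ≤ (D k).1).card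

/-- The distribution of pairwise minimal scores
`∑_{k : N_k ≥ 2} ∑_{i < i'} 1 / ((K₂ + 1) (N_k choose 2)) δ_{min (s Z_{k,i}) (s Z_{k,i'})}
  + 1 / (K₂ + 1) δ_{+∞}`, where `K₂` is the number of groups with at least two entries. -/
noncomputable def pairScoreLaw {K : ℕ} (D : Fin K → DataGroup 𝓧 𝓨) (s : 𝓧 × 𝓨 → ℝ) :
    Measure EReal :=
  (∑ k ∈ Finset.univ.filter fun k => 2 ≤ (D k).1,
    ∑ i : Fin ((D k).1 : ℕ), ∑ i' ∈ Finset.Ioi i,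
      (((numGroupsTwo D + 1) * ((D k).1 : ℕ).choose 2 : ℕ) : ENNReal)⁻¹ •
        Measure.dirac ((min (s ((D k).2 i)) (s ((D k).2 i')) : ℝ) : EReal)) +
  ((numGroupsTwo D + 1 : ℕ) : ENNReal)⁻¹ • Measure.dirac (⊤ : EReal)

/-- The score function fitted to the training groups `D` together with a test group `z`. -/
def fittedScore {K : ℕ} (A : (Fin (K + 1) → DataGroup 𝓧 𝓨) → 𝓧 × 𝓨 → ℝ)
    (D : Fin K → DataGroup 𝓧 𝓨) (z : DataGroup 𝓧 𝓨) : 𝓧 × 𝓨 → ℝ :=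
  A (Fin.snoc (α := fun _ => DataGroup 𝓧 𝓨) D z)

/-- The set of test groups `z` for which the fitted score of the first entry of `z` is at most the
`(1 - α²)`-quantile of the distribution of pairwise minimal scores of the training groups. -/
def groupPredictionSet {K : ℕ} (A : (Fin (K + 1) → DataGroup 𝓧 𝓨) → 𝓧 × 𝓨 → ℝ) (α : ℝ)
    (D : Fin K → DataGroup 𝓧 𝓨) : Set (DataGroup 𝓧 𝓨) :=
  {z | ((fittedScore A D z z.head : ℝ) : EReal) ≤
    quantile (1 - α ^ 2) (pairScoreLaw D (fittedScore A D z))}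

/-- The full-conformal HCP² prediction set at the feature `x`: the responses `y` such that `(x, y)`
is the first entry of some group in `groupPredictionSet A α D`. -/
def predictionSet {K : ℕ} (A : (Fin (K + 1) → DataGroup 𝓧 𝓨) → 𝓧 × 𝓨 → ℝ) (α : ℝ)
    (D : Fin K → DataGroup 𝓧 𝓨) (x : 𝓧) : Set 𝓨 :=
  {y | (x, y) ∈ DataGroup.head '' groupPredictionSet A α D}

/-- The conditional miscoverage rate `α_D(x)`: the probability that a response drawn from `PY x`
lies outside the prediction set at `x`. It is the outer probability if that event is not
measurable (the prediction set is a projection of a measurable set). -/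
noncomputable def miscoverage [MeasurableSpace 𝓧] [MeasurableSpace 𝓨] {K : ℕ}
    (PY : Kernel 𝓧 𝓨) (A : (Fin (K + 1) → DataGroup 𝓧 𝓨) → 𝓧 × 𝓨 → ℝ) (α : ℝ)
    (D : Fin K → DataGroup 𝓧 𝓨) (x : 𝓧) : ENNReal :=
  PY x (predictionSet A α D x)ᶜ

end Method

/-! The square of the miscoverage is the probability of a pair event. For fixed `D`, `x` and any `n
≥ 2`, it is the (outer) probability that the first two of `n` i.i.d. responses both miss the
prediction set. A missed response scores above the quantile: the group reordered to start with it is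
excluded, and by symmetry all reorderings of the group share one score function. So the smaller of
the two scores exceeds the quantile. Adding the test group to the count then shows that the pair is
extreme: the pairs with at least this minimal score have mass at most `α²` times the number of
groups of size at least two, each such group having mass one (`tailMass_le_of_quantile_lt`,
`miscoverage_sq_le_lintegral`).

Extremeness is symmetric in all `K + 1` groups, so exchangeability applies twice. Within the test
group the first pair may be replaced by the average pair (`lintegral_pi_eq_lintegral_pairMean`).
Across groups the test group may be replaced by the average group, and there the bound is
deterministic (`sum_pairMean_extremeIndicator_le`). This gives `α² P(N ≥ 2)` in
`lintegral_extremeMean_le`, and conditioning on `N ≥ 2` divides by that probability.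

The miscoverage does not involve a test group size, while `N` may depend on `X`. The pair bound
holds for every `n ≥ 2`, so its infimum over `n` is a measurable majorant in `(D, x)`, and it is at
most the value at the size actually drawn with `X`. -/

/-! ### Averages over pairs and exchangeability of i.i.d. samples -/

/-- The average of `f i j` over the ordered pairs `i ≠ j`; it is zero if there are none. -/
noncomputable def pairMean {n : ℕ} (f : Fin n → Fin n → ENNReal) : ENNReal :=
  ((n * (n - 1) : ℕ) : ENNReal)⁻¹ * ∑ i, ∑ j ∈ Finset.univ.erase i, f i j

theorem pairMean_of_lt_two {n : ℕ} (hn : n < 2) (f : Fin n → Fin n → ENNReal) :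
    pairMean f = 0 := by
  have h : ∑ i, ∑ j ∈ Finset.univ.erase i, f i j = 0 := by
    refine Finset.sum_eq_zero fun i _ => Finset.sum_eq_zero fun j hj => ?_
    have h := Finset.ne_of_mem_erase hj
    exact absurd (Fin.ext (by omega)) h
  rw [pairMean, h, mul_zero]

theorem natCast_pairs_ne_zero {n : ℕ} (hn : 2 ≤ n) : ((n * (n - 1) : ℕ) : ENNReal) ≠ 0 :=
  Nat.cast_ne_zero.2 (Nat.mul_ne_zero (by omega) (by omega))

theorem pairMean_const {n : ℕ} (hn : 2 ≤ n) (c : ENNReal) :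
    pairMean (fun _ _ : Fin n => c) = c := by
  have h : ∑ i : Fin n, ∑ _j ∈ Finset.univ.erase i, c = ((n * (n - 1) : ℕ) : ENNReal) * c := by
    simp [Finset.card_erase_of_mem, mul_assoc]
  rw [pairMean, h, ← mul_assoc,
    ENNReal.inv_mul_cancel (natCast_pairs_ne_zero hn) (ENNReal.natCast_ne_top _), one_mul]

theorem pairMean_mono {n : ℕ} {f g : Fin n → Fin n → ENNReal} (h : ∀ i j, f i j ≤ g i j) :
    pairMean f ≤ pairMean g :=
  mul_le_mul_right (Finset.sum_le_sum fun i _ => Finset.sum_le_sum fun j _ => h i j) _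

theorem pairMean_add {n : ℕ} (f g : Fin n → Fin n → ENNReal) :
    pairMean (fun i j => f i j + g i j) = pairMean f + pairMean g := by
  simp only [pairMean, Finset.sum_add_distrib, mul_add]

theorem pairMean_comp_perm {n : ℕ} (f : Fin n → Fin n → ENNReal) (σ : Equiv.Perm (Fin n)) :
    pairMean (fun i j => f (σ i) (σ j)) = pairMean f := by
  unfold pairMean
  congr 1
  rw [← Equiv.sum_comp σ fun i => ∑ j ∈ Finset.univ.erase i, f i j]
  refine Finset.sum_congr rfl fun i _ => ?_
  refine Finset.sum_equiv σ (fun j => ?_) fun j _ => rfl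
  simp

/-- Ordered pairs suit permutations, while `pairScoreLaw` uses pairs `i < j`; for symmetric `f` each
unordered pair is counted twice. -/
theorem pairMean_eq_sum_Ioi {n : ℕ} (f : Fin n → Fin n → ENNReal)
    (hf : ∀ i j, f i j = f j i) :
    pairMean f = ∑ i, ∑ j ∈ Finset.Ioi i, ((n.choose 2 : ℕ) : ENNReal)⁻¹ * f i j := by
  rcases lt_or_ge n 2 with hn | hn
  · rw [pairMean_of_lt_two hn]
    refine (Finset.sum_eq_zero fun i _ => Finset.sum_eq_zero fun j hj => ?_).symm
    have h := Finset.mem_Ioi.1 hj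
    omega
  have h1 : ∑ i, ∑ j ∈ Finset.univ.erase i, f i j = 2 * ∑ i, ∑ j ∈ Finset.Ioi i, f i j := by
    have h2 : ∀ i : Fin n, Finset.univ.erase i = (Finset.Ioi i).disjUnion (Finset.Iio i)
        (Finset.disjoint_left.2 fun j hj hj' =>
          lt_asymm (Finset.mem_Ioi.1 hj) (Finset.mem_Iio.1 hj')) := by
      intro i
      ext j
      simp only [Finset.mem_erase, Finset.mem_univ, and_true, Finset.mem_disjUnion,
        Finset.mem_Ioi, Finset.mem_Iio]
      exact ne_iff_lt_or_gt.trans or_comm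
    have h3 : ∑ i, ∑ j ∈ Finset.Iio i, f i j = ∑ i, ∑ j ∈ Finset.Ioi i, f i j := by
      rw [Finset.sum_comm' (t' := Finset.univ) (s' := fun j => Finset.Ioi j) (by simp)]
      exact Finset.sum_congr rfl fun i _ => Finset.sum_congr rfl fun j _ => hf _ _
    simp_rw [h2, Finset.sum_disjUnion, Finset.sum_add_distrib, h3, two_mul]
  have h4 : ((n * (n - 1) : ℕ) : ENNReal) = ((n.choose 2 : ℕ) : ENNReal) * 2 := by
    rw [Nat.choose_two_right]
    exact_mod_cast (Nat.div_mul_cancel (even_iff_two_dvd.1 (Nat.even_mul_pred_self n))).symm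
  simp_rw [← Finset.mul_sum]
  rw [pairMean, h1, h4, ENNReal.mul_inv (Or.inr (by simp)) (Or.inr (by simp)), mul_assoc,
    ← mul_assoc (2⁻¹ : ENNReal), ENNReal.inv_mul_cancel (by simp) (by simp), one_mul]

theorem exists_perm_apply_eq_of_ne {ι : Type*} [DecidableEq ι] {a b i j : ι} (hab : a ≠ b)
    (hij : i ≠ j) : ∃ σ : Equiv.Perm ι, σ a = i ∧ σ b = j := by
  refine ⟨(Equiv.swap a i).trans (Equiv.swap (Equiv.swap a i b) j), ?_, by simp⟩
  have h : Equiv.swap a i b ≠ i := fun h =>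
    hab ((Equiv.swap a i).injective ((Equiv.swap_apply_left a i).trans h.symm))
  simp [Equiv.swap_apply_of_ne_of_ne h.symm hij]

/-- For an i.i.d. sample, a statistic of the pair `(a, b)` that is equivariant under permutations
of the sample has the same expectation as its average over all pairs. -/
theorem lintegral_pi_eq_lintegral_pairMean {Ω : Type*} [MeasurableSpace Ω] (μ : Measure Ω)
    [IsProbabilityMeasure μ] {n : ℕ} (φ : (Fin n → Ω) → Fin n → Fin n → ENNReal)
    (hφ : ∀ i j, Measurable fun y => φ y i j)
    (hperm : ∀ y (σ : Equiv.Perm (Fin n)) i j, φ (y ∘ σ) i j = φ y (σ i) (σ j))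
    {a b : Fin n} (hab : a ≠ b) :
    ∫⁻ y, φ y a b ∂Measure.pi (fun _ => μ) =
      ∫⁻ y, pairMean (φ y) ∂Measure.pi (fun _ => μ) := by
  have hn : 2 ≤ n := by
    by_contra h
    exact hab (Fin.ext (by omega))
  have key : ∀ i j, i ≠ j → ∫⁻ y, φ y i j ∂Measure.pi (fun _ => μ) =
      ∫⁻ y, φ y a b ∂Measure.pi (fun _ => μ) := by
    intro i j hij
    obtain ⟨σ, rfl, rfl⟩ := exists_perm_apply_eq_of_ne hab hij
    -- Reindexing the sample preserves the product law, and equivariance turns it into moving the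
    -- pair `(a, b)` to `(σ a, σ b)`.
    have h := measurePreserving_piCongrLeft (fun _ : Fin n => μ) σ.symm
    rw [← h.lintegral_comp (hφ a b)]
    refine lintegral_congr fun y => ?_
    rw [← hperm]
    congr 1
    funext x
    obtain ⟨w, rfl⟩ := σ.symm.surjective x
    rw [MeasurableEquiv.coe_piCongrLeft, Equiv.piCongrLeft_apply_apply]
    simp
  unfold pairMean
  rw [lintegral_const_mul _ (Finset.measurable_sum _ fun i _ => Finset.measurable_sum _
    fun j _ => hφ i j), lintegral_finsetSum _ fun i _ => Finset.measurable_sum _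
    fun j _ => hφ i j]
  have h : ∀ i, ∫⁻ y, ∑ j ∈ Finset.univ.erase i, φ y i j ∂Measure.pi (fun _ => μ) =
      ∑ j ∈ Finset.univ.erase i, ∫⁻ y, φ y a b ∂Measure.pi (fun _ => μ) := fun i => by
    rw [lintegral_finsetSum _ fun j _ => hφ i j]
    exact Finset.sum_congr rfl fun j hj => key i j (Finset.ne_of_mem_erase hj).symm
  simp_rw [h]
  exact (pairMean_const hn _).symm

/-! ### Extreme pairs and their symmetry -/

section

variable {𝓧 𝓨 : Type*}

/-- The average, over the pairs of entries of a group, of the indicator that the smaller of the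
two scores is at least `v`. -/
noncomputable def groupTail (s : 𝓧 × 𝓨 → ℝ) (z : DataGroup 𝓧 𝓨) (v : ℝ) : ENNReal :=
  pairMean fun i j => (Set.Ici v).indicator 1 (min (s (z.2 i)) (s (z.2 j)))

/-- The sum of `groupTail` over a family of groups. -/
noncomputable def tailMass {m : ℕ} (s : 𝓧 × 𝓨 → ℝ) (Z : Fin m → DataGroup 𝓧 𝓨) (v : ℝ) :
    ENNReal :=
  ∑ k, groupTail s (Z k) v

/-- The indicator that a pair with minimal score `v` is among the fraction `a` of the most extreme
pairs. -/
noncomputable def extremeIndicator {m : ℕ} (s : 𝓧 × 𝓨 → ℝ) (a : ENNReal)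
    (Z : Fin m → DataGroup 𝓧 𝓨) (v : ℝ) : ENNReal :=
  {w : ℝ | tailMass s Z w ≤ a * numGroupsTwo Z}.indicator 1 v

theorem groupTail_permute (s : 𝓧 × 𝓨 → ℝ) (z : DataGroup 𝓧 𝓨)
    (σ : Equiv.Perm (Fin (z.1 : ℕ))) (v : ℝ) :
    groupTail s (z.permute σ) v = groupTail s z v :=
  pairMean_comp_perm (fun i j => (Set.Ici v).indicator 1 (min (s (z.2 i)) (s (z.2 j)))) σ

theorem tailMass_comp_perm {m : ℕ} (s : 𝓧 × 𝓨 → ℝ) (Z : Fin m → DataGroup 𝓧 𝓨)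
    (σ : Equiv.Perm (Fin m)) (v : ℝ) : tailMass s (Z ∘ σ) v = tailMass s Z v :=
  Equiv.sum_comp σ fun k => groupTail s (Z k) v

theorem numGroupsTwo_eq_sum {m : ℕ} (Z : Fin m → DataGroup 𝓧 𝓨) :
    numGroupsTwo Z = ∑ k, if 2 ≤ (Z k).1 then 1 else 0 :=
  Finset.card_filter _ _

theorem numGroupsTwo_comp_perm {m : ℕ} (Z : Fin m → DataGroup 𝓧 𝓨)
    (σ : Equiv.Perm (Fin m)) : numGroupsTwo (Z ∘ σ) = numGroupsTwo Z := by
  rw [numGroupsTwo_eq_sum, numGroupsTwo_eq_sum]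
  exact Equiv.sum_comp σ fun k => if 2 ≤ (Z k).1 then 1 else 0

theorem extremeIndicator_comp_perm {m : ℕ} (s : 𝓧 × 𝓨 → ℝ) (a : ENNReal)
    (Z : Fin m → DataGroup 𝓧 𝓨) (σ : Equiv.Perm (Fin m)) (v : ℝ) :
    extremeIndicator s a (Z ∘ σ) v = extremeIndicator s a Z v := by
  simp only [extremeIndicator, tailMass_comp_perm, numGroupsTwo_comp_perm]

theorem tailMass_snoc {m : ℕ} (s : 𝓧 × 𝓨 → ℝ) (D : Fin m → DataGroup 𝓧 𝓨)
    (z : DataGroup 𝓧 𝓨) (v : ℝ) :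
    tailMass s (Fin.snoc (α := fun _ => DataGroup 𝓧 𝓨) D z) v =
      tailMass s D v + groupTail s z v := by
  simp [tailMass, Fin.sum_univ_castSucc]

theorem numGroupsTwo_snoc {m : ℕ} (D : Fin m → DataGroup 𝓧 𝓨) (z : DataGroup 𝓧 𝓨) :
    numGroupsTwo (Fin.snoc (α := fun _ => DataGroup 𝓧 𝓨) D z) =
      numGroupsTwo D + if 2 ≤ z.1 then 1 else 0 := by
  simp only [numGroupsTwo_eq_sum, Fin.sum_univ_castSucc, Fin.snoc_castSucc, Fin.snoc_last]

theorem extremeIndicator_snoc_permute {m : ℕ} (s : 𝓧 × 𝓨 → ℝ) (a : ENNReal)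
    (D : Fin m → DataGroup 𝓧 𝓨) (z : DataGroup 𝓧 𝓨) (σ : Equiv.Perm (Fin (z.1 : ℕ))) (v : ℝ) :
    extremeIndicator s a (Fin.snoc (α := fun _ => DataGroup 𝓧 𝓨) D (z.permute σ)) v =
      extremeIndicator s a (Fin.snoc (α := fun _ => DataGroup 𝓧 𝓨) D z) v := by
  simp only [extremeIndicator, tailMass_snoc, numGroupsTwo_snoc, groupTail_permute]
  rfl

theorem IsHierarchicallySymmetric.snoc_permute {m : ℕ}
    {A : (Fin (m + 1) → DataGroup 𝓧 𝓨) → 𝓧 × 𝓨 → ℝ} (hA : IsHierarchicallySymmetric A)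
    (D : Fin m → DataGroup 𝓧 𝓨) (z : DataGroup 𝓧 𝓨) (σ : Equiv.Perm (Fin (z.1 : ℕ))) :
    A (Fin.snoc (α := fun _ => DataGroup 𝓧 𝓨) D (z.permute σ)) =
      A (Fin.snoc (α := fun _ => DataGroup 𝓧 𝓨) D z) := by
  -- The last entry of the `snoc` equals `z` only propositionally, and the type of `σ` depends on
  -- the group, so the permutation is transported along the equality.
  have h : ∀ w (_ : w = z), ∃ τ : Equiv.Perm (Fin (w.1 : ℕ)), w.permute τ = z.permute σ := by
    rintro _ rfl
    exact ⟨σ, rfl⟩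
  obtain ⟨τ, hτ⟩ := h _ (Fin.snoc_last (α := fun _ => DataGroup 𝓧 𝓨) z D)
  rw [← hA.perm_within _ (Fin.last m) τ, hτ, Fin.update_snoc_last]

/-- In total, the extreme pairs have at most the fraction `a` of the mass. -/
theorem sum_pairMean_extremeIndicator_le {m : ℕ} (s : 𝓧 × 𝓨 → ℝ) (a : ENNReal)
    (Z : Fin m → DataGroup 𝓧 𝓨) :
    ∑ k, pairMean (fun i j =>
      extremeIndicator s a Z (min (s ((Z k).2 i)) (s ((Z k).2 j)))) ≤ a * numGroupsTwo Z := by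
  classical
  set E : Set ℝ := {w : ℝ | tailMass s Z w ≤ a * numGroupsTwo Z} with hE
  -- The finitely many extreme values that occur. Every extreme pair has score at least the smallest
  -- of them, so the extreme pairs weigh at most the tail mass there, which is bounded because that
  -- value is itself extreme.
  let T : Finset ℝ := (Finset.univ.image fun p : (k : Fin m) × Fin ((Z k).1 : ℕ) ×
    Fin ((Z k).1 : ℕ) => min (s ((Z p.1).2 p.2.1)) (s ((Z p.1).2 p.2.2))).filter (· ∈ E)
  have hT : ∀ k i j, min (s ((Z k).2 i)) (s ((Z k).2 j)) ∈ E →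
      min (s ((Z k).2 i)) (s ((Z k).2 j)) ∈ T := fun k i j h =>
    Finset.mem_filter.2 ⟨Finset.mem_image.2 ⟨⟨k, i, j⟩, Finset.mem_univ _, rfl⟩, h⟩
  rcases T.eq_empty_or_nonempty with h0 | h0
  · refine (Finset.sum_eq_zero fun k _ => ?_).trans_le bot_le
    refine mul_eq_zero_of_right _ (Finset.sum_eq_zero fun i _ => Finset.sum_eq_zero fun j _ => ?_)
    refine Set.indicator_of_notMem (fun h => ?_) _
    have := hT k i j h
    simp [h0] at this
  · have hmin : T.min' h0 ∈ E := (Finset.mem_filter.1 (T.min'_mem h0)).2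
    refine le_trans (Finset.sum_le_sum fun k _ => pairMean_mono fun i j => ?_) hmin
    by_cases h : min (s ((Z k).2 i)) (s ((Z k).2 j)) ∈ E
    · rw [Set.indicator_of_mem (Set.mem_Ici.2 (T.min'_le _ (hT k i j h)))]
      exact Set.indicator_le_self _ _ _
    · exact (Set.indicator_of_notMem h _).trans_le bot_le

end

/-! ### From missed responses to extreme pairs -/

section

variable {𝓧 𝓨 : Type*}

/-- The entries of a group, continued periodically. -/
def DataGroup.entry (z : DataGroup 𝓧 𝓨) (i : ℕ) : 𝓧 × 𝓨 := z.2 ⟨i % z.1, Nat.mod_lt _ z.1.pos⟩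

theorem DataGroup.entry_val (z : DataGroup 𝓧 𝓨) (i : Fin (z.1 : ℕ)) : z.entry i = z.2 i :=
  congrArg z.2 (Fin.ext (Nat.mod_eq_of_lt i.2))

/-- The atom at `+∞` lies above every real `t`, so it enters only through the normalisation. -/
theorem pairScoreLaw_Iic {m : ℕ} (D : Fin m → DataGroup 𝓧 𝓨) (s : 𝓧 × 𝓨 → ℝ) (t : ℝ) :
    pairScoreLaw D s (Set.Iic (t : EReal)) = ((numGroupsTwo D + 1 : ℕ) : ENNReal)⁻¹ *
      ∑ k ∈ Finset.univ.filter fun k => 2 ≤ (D k).1,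
        pairMean fun i j => (Set.Iic t).indicator 1 (min (s ((D k).2 i)) (s ((D k).2 j))) := by
  have hI : ∀ x : ℝ, (Set.Iic (t : EReal)).indicator (1 : EReal → ENNReal) (x : EReal) =
      (Set.Iic t).indicator 1 x := by
    intro x
    by_cases h : x ≤ t <;> simp [h]
  simp only [pairScoreLaw, Measure.add_apply, Measure.finsetSum_apply, Measure.smul_apply,
    Measure.dirac_apply' _ measurableSet_Iic, smul_eq_mul, hI]
  rw [Set.indicator_of_notMem (by simp), mul_zero, add_zero, Finset.mul_sum]
  refine Finset.sum_congr rfl fun k _ => ?_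
  rw [pairMean_eq_sum_Ioi _ fun i j => by rw [min_comm], Finset.mul_sum]
  refine Finset.sum_congr rfl fun i _ => ?_
  rw [Finset.mul_sum]
  refine Finset.sum_congr rfl fun j _ => ?_
  rw [← mul_assoc, Nat.cast_mul, ENNReal.mul_inv (Or.inr (by simp)) (Or.inl (by simp))]

/-- Some real `t < v` carries mass at least `1 - α²`. In a group, the pairs at or below `t` and
those at or above `v` are disjoint, so they share mass one. The training pairs at or below `t` use
up `(1 - α²) (K₂ + 1)` of the total `K₂ + 1`, where `K₂` is the number of training groups of size at
least two and the extra one belongs to the test group. -/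
theorem tailMass_le_of_quantile_lt {m : ℕ} {α : ℝ} (hα : α ∈ Set.Icc (0 : ℝ) 1)
    (D : Fin m → DataGroup 𝓧 𝓨) (s : 𝓧 × 𝓨 → ℝ) (z : DataGroup 𝓧 𝓨) (hz : 2 ≤ z.1) {v : ℝ}
    (hv : quantile (1 - α ^ 2) (pairScoreLaw D s) < v) :
    tailMass s (Fin.snoc (α := fun _ => DataGroup 𝓧 𝓨) D z) v ≤
      ENNReal.ofReal (α ^ 2) *
        numGroupsTwo (Fin.snoc (α := fun _ => DataGroup 𝓧 𝓨) D z) := by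
  obtain ⟨_, ⟨t, ht, rfl⟩, htv⟩ := sInf_lt_iff.1 hv
  have htv : t < v := EReal.coe_lt_coe_iff.1 htv
  rw [numGroupsTwo_snoc, if_pos hz, tailMass_snoc]
  set M : ENNReal := ((numGroupsTwo D + 1 : ℕ) : ENNReal) with hM
  have hM0 : M ≠ 0 := by simp [hM]
  have hMt : M ≠ ⊤ := ENNReal.natCast_ne_top _
  set S := ∑ k ∈ Finset.univ.filter fun k => 2 ≤ (D k).1,
    pairMean fun i j => (Set.Iic t).indicator 1 (min (s ((D k).2 i)) (s ((D k).2 j))) with hS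
  have h1 : ENNReal.ofReal (1 - α ^ 2) * M ≤ S := by
    have h : ENNReal.ofReal (1 - α ^ 2) ≤ pairScoreLaw D s (Set.Iic (t : EReal)) :=
      (ENNReal.ofReal_le_ofReal ht).trans ENNReal.ofReal_toReal_le
    rw [pairScoreLaw_Iic, ← hM, ← hS] at h
    calc ENNReal.ofReal (1 - α ^ 2) * M ≤ M⁻¹ * S * M := mul_le_mul_left h M
      _ = S := by rw [mul_comm, ← mul_assoc, ENNReal.mul_inv_cancel hM0 hMt, one_mul]
  have h2 : ∀ w : DataGroup 𝓧 𝓨, 2 ≤ w.1 → groupTail s w v +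
      pairMean (fun i j => (Set.Iic t).indicator 1 (min (s (w.2 i)) (s (w.2 j)))) ≤ 1 := by
    intro w hw
    rw [groupTail, ← pairMean_add, ← pairMean_const (n := w.1) (by exact_mod_cast hw) 1]
    refine pairMean_mono fun i j => ?_
    rcases le_or_gt v (min (s (w.2 i)) (s (w.2 j))) with h | h
    · rw [Set.indicator_of_notMem (s := Set.Iic t)
        (fun h' => absurd (h.trans h') (not_le.2 htv)), add_zero]
      exact Set.indicator_le_self _ _ _
    · rw [Set.indicator_of_notMem (s := Set.Ici v) (not_le.2 h), zero_add]
      exact Set.indicator_le_self _ _ _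
  have h3 : tailMass s D v =
      ∑ k ∈ Finset.univ.filter fun k => 2 ≤ (D k).1, groupTail s (D k) v := by
    refine (Finset.sum_filter_of_ne fun k _ hk => ?_).symm
    by_contra h
    exact hk (pairMean_of_lt_two (by exact_mod_cast not_le.1 h) _)
  have h4 : tailMass s D v + S ≤ numGroupsTwo D := by
    rw [h3, hS, ← Finset.sum_add_distrib]
    refine (Finset.sum_le_card_nsmul _ _ 1 fun k hk => h2 _ (Finset.mem_filter.1 hk).2).trans ?_
    simp [numGroupsTwo]
  have h5 : groupTail s z v ≤ 1 := le_self_add.trans (h2 z hz)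
  have h6 : M = ENNReal.ofReal (α ^ 2) * M + ENNReal.ofReal (1 - α ^ 2) * M := by
    rw [← add_mul, ← ENNReal.ofReal_add (by positivity) (by nlinarith [hα.1, hα.2])]
    simp
  -- Instead of subtracting in `ENNReal`, the finite term `(1 - α²) M` is added to both sides.
  refine (ENNReal.add_le_add_iff_right (a := ENNReal.ofReal (1 - α ^ 2) * M)
    (ENNReal.mul_ne_top ENNReal.ofReal_ne_top hMt)).1 ?_
  rw [← h6]
  calc _ ≤ tailMass s D v + groupTail s z v + S := add_le_add_right h1 _
    _ = tailMass s D v + S + groupTail s z v := add_right_comm _ _ _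
    _ ≤ numGroupsTwo D + 1 := add_le_add h4 h5
    _ = M := by rw [hM]; push_cast; rfl

/-- If the first two responses of a group are outside the prediction set, then this pair of
entries is extreme. -/
theorem extremeIndicator_eq_one_of_notMem_predictionSet {m : ℕ} {α : ℝ}
    (hα : α ∈ Set.Icc (0 : ℝ) 1) {A : (Fin (m + 1) → DataGroup 𝓧 𝓨) → 𝓧 × 𝓨 → ℝ}
    (hA : IsHierarchicallySymmetric A) (D : Fin m → DataGroup 𝓧 𝓨) (x : 𝓧) {n : ℕ+}
    (hn : 2 ≤ n) (y : Fin (n : ℕ) → 𝓨) (i j : Fin (n : ℕ))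
    (hi : y i ∉ predictionSet A α D x) (hj : y j ∉ predictionSet A α D x) :
    extremeIndicator (fittedScore A D (.ofResponses n x y)) (ENNReal.ofReal (α ^ 2))
      (Fin.snoc (α := fun _ => DataGroup 𝓧 𝓨) D (.ofResponses n x y))
      (min (fittedScore A D (.ofResponses n x y) (x, y i))
        (fittedScore A D (.ofResponses n x y) (x, y j))) = 1 := by
  have key : ∀ l, y l ∉ predictionSet A α D x → quantile (1 - α ^ 2)
      (pairScoreLaw D (fittedScore A D (.ofResponses n x y))) <
        (fittedScore A D (.ofResponses n x y) (x, y l) : ℝ) := by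
    intro l hl
    by_contra h
    have hhead : ((DataGroup.ofResponses n x y).permute (Equiv.swap ⟨0, n.pos⟩ l)).head =
        (x, y l) := by
      change (x, y (Equiv.swap ⟨0, n.pos⟩ l ⟨0, n.pos⟩)) = (x, y l)
      rw [Equiv.swap_apply_left]
    -- The prediction set is a projection, so any group with head `(x, y l)` is an admissible
    -- witness; swapping `l` to the front gives one with unchanged fitted score.
    refine hl ⟨(DataGroup.ofResponses n x y).permute (Equiv.swap ⟨0, n.pos⟩ l), ?_, ?_⟩
    · have hs : fittedScore A D ((DataGroup.ofResponses n x y).permute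
          (Equiv.swap ⟨0, n.pos⟩ l)) = fittedScore A D (.ofResponses n x y) :=
        hA.snoc_permute D _ _
      rw [groupPredictionSet, Set.mem_ofPred_eq, hs, hhead]
      exact not_lt.1 h
    · exact hhead
  refine Set.indicator_of_mem ?_ _
  refine tailMass_le_of_quantile_lt hα _ _ _ hn ?_
  rcases min_choice (fittedScore A D (.ofResponses n x y) (x, y i))
    (fittedScore A D (.ofResponses n x y) (x, y j)) with h | h <;> rw [h]
  exacts [key i hi, key j hj]

end

/-! ### Measurability -/

section

variable {𝓧 𝓨 : Type*} [MeasurableSpace 𝓧] [MeasurableSpace 𝓨]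

namespace DataGroup

theorem measurable_of_forall_mk {β : Type*} [MeasurableSpace β] {f : DataGroup 𝓧 𝓨 → β}
    (hf : ∀ n : ℕ+, Measurable fun z : Fin (n : ℕ) → 𝓧 × 𝓨 => f ⟨n, z⟩) : Measurable f :=
  fun _ hs => MeasurableSpace.measurableSet_iInf.2 fun n => hf n hs

theorem measurable_size : Measurable fun z : DataGroup 𝓧 𝓨 => z.1 :=
  measurable_of_forall_mk fun _ => measurable_const

theorem measurable_entry (i : ℕ) : Measurable fun z : DataGroup 𝓧 𝓨 => z.entry i :=
  measurable_of_forall_mk fun n => measurable_pi_apply (⟨i % n, Nat.mod_lt _ n.pos⟩ : Fin (n : ℕ))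

end DataGroup

/-- Indexing `f` by `ℕ` instead of by the varying `Fin` type lets the size be frozen; there are only
countably many sizes. -/
theorem measurable_pairMean {Ω : Type*} [MeasurableSpace Ω] {size : Ω → ℕ+}
    (hsize : Measurable size) {f : Ω → ℕ → ℕ → ENNReal}
    (hf : ∀ i j, Measurable fun ω => f ω i j) :
    Measurable fun ω => pairMean (n := size ω) fun i j => f ω i j := by
  have h (n : ℕ+) : Measurable fun ω => pairMean (n := n) fun i j => f ω i j := by
    have h1 : Measurable fun ω => ∑ i : Fin (n : ℕ), ∑ j ∈ Finset.univ.erase i, f ω i j :=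
      Finset.measurable_sum _ fun i _ => Finset.measurable_sum _ fun j _ => hf i j
    exact h1.const_mul _
  have h2 : Measurable fun p : Ω × ℕ+ => pairMean (n := p.2) fun i j => f p.1 i j :=
    measurable_from_prod_countable_left h
  have h3 : Measurable fun ω => (ω, size ω) := measurable_id.prodMk hsize
  have h4 := h2.comp h3
  simp only [Function.comp_def] at h4
  exact h4

theorem measurable_tailMass {Ω : Type*} [MeasurableSpace Ω] {m : ℕ} {s : Ω → 𝓧 × 𝓨 → ℝ}
    (hs : Measurable (Function.uncurry s)) {Z : Ω → Fin m → DataGroup 𝓧 𝓨} (hZ : Measurable Z)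
    {v : Ω → ℝ} (hv : Measurable v) : Measurable fun ω => tailMass (s ω) (Z ω) (v ω) := by
  refine Finset.measurable_sum _ fun k _ => ?_
  have hk : Measurable fun ω => Z ω k := (measurable_pi_apply k).comp hZ
  have he : ∀ i, Measurable fun ω => s ω ((Z ω k).entry i) := fun i =>
    hs.comp (measurable_id.prodMk ((DataGroup.measurable_entry i).comp hk))
  have h := measurable_pairMean (DataGroup.measurable_size.comp hk)
    (f := fun ω i j => (Set.Ici (v ω)).indicator 1
      (min (s ω ((Z ω k).entry i)) (s ω ((Z ω k).entry j)))) fun i j => by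
    have hset : MeasurableSet {ω | v ω ≤ min (s ω ((Z ω k).entry i)) (s ω ((Z ω k).entry j))} :=
      measurableSet_le hv ((he i).min (he j))
    exact (measurable_one (α := ENNReal)).indicator hset
  convert h using 2 with ω
  unfold groupTail
  congr 1
  funext i j
  simp only [DataGroup.entry_val]

theorem measurable_numGroupsTwo {m : ℕ} :
    Measurable fun Z : Fin m → DataGroup 𝓧 𝓨 => numGroupsTwo Z := by
  simp only [numGroupsTwo_eq_sum]
  exact Finset.measurable_sum _ fun k _ => (measurable_from_top (f := fun n : ℕ+ =>
    if 2 ≤ n then 1 else 0)).comp (DataGroup.measurable_size.comp (measurable_pi_apply k))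

theorem measurable_extremeIndicator {Ω : Type*} [MeasurableSpace Ω] {m : ℕ}
    {s : Ω → 𝓧 × 𝓨 → ℝ} (hs : Measurable (Function.uncurry s)) (a : ENNReal)
    {Z : Ω → Fin m → DataGroup 𝓧 𝓨} (hZ : Measurable Z) {v : Ω → ℝ} (hv : Measurable v) :
    Measurable fun ω => extremeIndicator (s ω) a (Z ω) (v ω) := by
  have hset : MeasurableSet {ω | tailMass (s ω) (Z ω) (v ω) ≤ a * numGroupsTwo (Z ω)} :=
    measurableSet_le (measurable_tailMass hs hZ hv)
      (((measurable_from_top (f := fun n : ℕ => (n : ENNReal))).comp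
        (measurable_numGroupsTwo.comp hZ)).const_mul a)
  exact (measurable_one (α := ENNReal)).indicator hset

end

/-! ### Extreme pairs of the fitted score -/

section

variable {𝓧 𝓨 : Type*} {m : ℕ}

/-- The indicator that the pair of the entries `i` and `j` of the group `k` is extreme. -/
noncomputable def pairExtreme (A : (Fin m → DataGroup 𝓧 𝓨) → 𝓧 × 𝓨 → ℝ) (a : ENNReal)
    (Z : Fin m → DataGroup 𝓧 𝓨) (k : Fin m) (i j : ℕ) : ENNReal :=
  extremeIndicator (A Z) a Z (min (A Z ((Z k).entry i)) (A Z ((Z k).entry j)))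

/-- The fraction of extreme pairs in the group `k`. -/
noncomputable def extremeMean (A : (Fin m → DataGroup 𝓧 𝓨) → 𝓧 × 𝓨 → ℝ) (a : ENNReal)
    (Z : Fin m → DataGroup 𝓧 𝓨) (k : Fin m) : ENNReal :=
  pairMean (n := (Z k).1) fun i j => pairExtreme A a Z k i j

theorem sum_extremeMean_le (A : (Fin m → DataGroup 𝓧 𝓨) → 𝓧 × 𝓨 → ℝ) (a : ENNReal)
    (Z : Fin m → DataGroup 𝓧 𝓨) : ∑ k, extremeMean A a Z k ≤ a * numGroupsTwo Z := by
  refine le_of_eq_of_le ?_ (sum_pairMean_extremeIndicator_le (A Z) a Z)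
  simp only [extremeMean, pairExtreme, DataGroup.entry_val]

/-- The score function and the extremeness threshold see only the unordered family of groups, so
only the index moves. -/
theorem extremeMean_comp_perm {A : (Fin (m + 1) → DataGroup 𝓧 𝓨) → 𝓧 × 𝓨 → ℝ}
    (hA : IsHierarchicallySymmetric A) (a : ENNReal) (Z : Fin (m + 1) → DataGroup 𝓧 𝓨)
    (σ : Equiv.Perm (Fin (m + 1))) (k : Fin (m + 1)) :
    extremeMean A a (Z ∘ σ) k = extremeMean A a Z (σ k) := by
  simp only [extremeMean, pairExtreme, hA.perm_groups, extremeIndicator_comp_perm]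
  rfl

end

/-! ### Integration over groups and the two exchangeability steps -/

section

variable {𝓧 𝓨 : Type*} [MeasurableSpace 𝓧] [MeasurableSpace 𝓨]

instance instIsMarkovKernelGroupKernel (PY : Kernel 𝓧 𝓨) [IsMarkovKernel PY] :
    IsMarkovKernel (groupKernel PY) :=
  ⟨fun p => Measure.isProbabilityMeasure_map
    ((measurable_group_ofResponses p.2).comp measurable_prodMk_left).aemeasurable⟩

instance instIsProbabilityMeasureGroupLaw (PX : Measure 𝓧) [IsProbabilityMeasure PX]
    (PN : Kernel 𝓧 ℕ+) [IsMarkovKernel PN] (PY : Kernel 𝓧 𝓨) [IsMarkovKernel PY] :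
    IsProbabilityMeasure (groupLaw PX PN PY) := by
  unfold groupLaw
  infer_instance

theorem lintegral_groupKernel (PY : Kernel 𝓧 𝓨) [IsMarkovKernel PY] (x : 𝓧) (n : ℕ+)
    {f : DataGroup 𝓧 𝓨 → ENNReal} (hf : Measurable f) :
    ∫⁻ z, f z ∂groupKernel PY (x, n) =
      ∫⁻ y, f (.ofResponses n x y) ∂Measure.pi fun _ : Fin (n : ℕ) => PY x :=
  lintegral_map hf ((measurable_group_ofResponses n).comp measurable_prodMk_left)

theorem lintegral_groupLaw (PX : Measure 𝓧) (PN : Kernel 𝓧 ℕ+) (PY : Kernel 𝓧 𝓨)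
    [IsMarkovKernel PY] {f : DataGroup 𝓧 𝓨 → ENNReal} (hf : Measurable f) :
    ∫⁻ z, f z ∂groupLaw PX PN PY = ∫⁻ p, ∫⁻ z, f z ∂groupKernel PY p ∂(PX ⊗ₘ PN) :=
  Measure.lintegral_bind (groupKernel PY).measurable.aemeasurable hf.aemeasurable

theorem measurableSet_two_le_size : MeasurableSet {z : DataGroup 𝓧 𝓨 | 2 ≤ z.1} :=
  DataGroup.measurable_size (MeasurableSet.of_discrete (s := {n : ℕ+ | 2 ≤ n}))

theorem measurableSet_two_le_snd : MeasurableSet {p : 𝓧 × ℕ+ | 2 ≤ p.2} :=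
  measurable_snd (MeasurableSet.of_discrete (s := {n : ℕ+ | 2 ≤ n}))

theorem groupLaw_two_le_size (PX : Measure 𝓧) (PN : Kernel 𝓧 ℕ+) (PY : Kernel 𝓧 𝓨)
    [IsMarkovKernel PY] :
    groupLaw PX PN PY {z | 2 ≤ z.1} = (PX ⊗ₘ PN) {p : 𝓧 × ℕ+ | 2 ≤ p.2} := by
  rw [← lintegral_indicator_one measurableSet_two_le_size,
    ← lintegral_indicator_one measurableSet_two_le_snd, lintegral_groupLaw _ _ _
    (measurable_one.indicator measurableSet_two_le_size)]
  refine lintegral_congr fun p => ?_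
  rw [lintegral_groupKernel _ _ _ (measurable_one.indicator measurableSet_two_le_size)]
  calc _ = ∫⁻ _, {p : 𝓧 × ℕ+ | 2 ≤ p.2}.indicator (1 : 𝓧 × ℕ+ → ENNReal) p
        ∂Measure.pi fun _ : Fin (p.2 : ℕ) => PY p.1 := rfl
    _ = _ := by simp

variable {m : ℕ}

theorem measurable_snoc : Measurable fun p : (Fin m → DataGroup 𝓧 𝓨) × DataGroup 𝓧 𝓨 =>
    Fin.snoc (α := fun _ => DataGroup 𝓧 𝓨) p.1 p.2 := by
  refine measurable_pi_lambda _ fun k => ?_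
  induction k using Fin.lastCases with
  | last => simpa using measurable_snd
  | cast k => simpa using measurable_fst.eval

theorem measurable_pairExtreme {A : (Fin m → DataGroup 𝓧 𝓨) → 𝓧 × 𝓨 → ℝ}
    (hA : Measurable (Function.uncurry A)) (a : ENNReal) (k : Fin m) (i j : ℕ) :
    Measurable fun Z => pairExtreme A a Z k i j := by
  have he : ∀ i, Measurable fun Z => A Z ((Z k).entry i) := fun i =>
    hA.comp (measurable_id.prodMk ((DataGroup.measurable_entry i).comp (measurable_pi_apply k)))
  exact measurable_extremeIndicator hA a measurable_id ((he i).min (he j))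

theorem measurable_extremeMean {A : (Fin m → DataGroup 𝓧 𝓨) → 𝓧 × 𝓨 → ℝ}
    (hA : Measurable (Function.uncurry A)) (a : ENNReal) (k : Fin m) :
    Measurable fun Z => extremeMean A a Z k :=
  measurable_pairMean (DataGroup.measurable_size.comp (measurable_pi_apply k))
    fun i j => measurable_pairExtreme hA a k i j

/-- By exchangeability of the groups, the expected fraction of extreme pairs in one group is at
most `a` times the probability that the group has at least two entries. -/
theorem lintegral_extremeMean_le (μ : Measure (DataGroup 𝓧 𝓨)) [IsProbabilityMeasure μ]
    {A : (Fin (m + 1) → DataGroup 𝓧 𝓨) → 𝓧 × 𝓨 → ℝ} (hA_meas : Measurable (Function.uncurry A))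
    (hA : IsHierarchicallySymmetric A) (a : ENNReal) (k : Fin (m + 1)) :
    ∫⁻ Z, extremeMean A a Z k ∂Measure.pi (fun _ => μ) ≤ a * μ {z | 2 ≤ z.1} := by
  have hJ := measurable_extremeMean hA_meas a
  have hN : Measurable fun Z : Fin (m + 1) → DataGroup 𝓧 𝓨 => (numGroupsTwo Z : ENNReal) :=
    (measurable_from_top (f := fun n : ℕ => (n : ENNReal))).comp measurable_numGroupsTwo
  have h1 : ∀ l, ∫⁻ Z, extremeMean A a Z l ∂Measure.pi (fun _ => μ) =
      ∫⁻ Z, extremeMean A a Z k ∂Measure.pi (fun _ => μ) := by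
    intro l
    have h := measurePreserving_piCongrLeft (fun _ : Fin (m + 1) => μ) (Equiv.swap k l).symm
    rw [← h.lintegral_comp (hJ k)]
    refine lintegral_congr fun Z => ?_
    rw [show MeasurableEquiv.piCongrLeft (fun _ => DataGroup 𝓧 𝓨) (Equiv.swap k l).symm Z =
        Z ∘ Equiv.swap k l from ?_, extremeMean_comp_perm hA, Equiv.swap_apply_left]
    funext x
    obtain ⟨w, rfl⟩ := (Equiv.swap k l).symm.surjective x
    rw [MeasurableEquiv.coe_piCongrLeft, Equiv.piCongrLeft_apply_apply]
    simp
  have h2 : ∫⁻ Z, (numGroupsTwo Z : ENNReal) ∂Measure.pi (fun _ : Fin (m + 1) => μ) =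
      ((m + 1 : ℕ) : ENNReal) * μ {z | 2 ≤ z.1} := by
    have h3 : ∀ Z : Fin (m + 1) → DataGroup 𝓧 𝓨, (numGroupsTwo Z : ENNReal) =
        ∑ l, {z : DataGroup 𝓧 𝓨 | 2 ≤ z.1}.indicator 1 (Z l) := by
      intro Z
      rw [numGroupsTwo_eq_sum, Nat.cast_sum]
      refine Finset.sum_congr rfl fun l _ => ?_
      by_cases h : 2 ≤ (Z l).1 <;> simp [h]
    have h4 : Measurable ({z : DataGroup 𝓧 𝓨 | 2 ≤ z.1}.indicator (1 : DataGroup 𝓧 𝓨 → ENNReal)) :=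
      measurable_one.indicator measurableSet_two_le_size
    simp_rw [h3]
    have h6 : ∀ l : Fin (m + 1), Measurable fun Z : Fin (m + 1) → DataGroup 𝓧 𝓨 =>
        {z : DataGroup 𝓧 𝓨 | 2 ≤ z.1}.indicator (1 : DataGroup 𝓧 𝓨 → ENNReal) (Z l) :=
      fun l => h4.comp (measurable_pi_apply l)
    have h5 : ∀ l : Fin (m + 1), ∫⁻ Z : Fin (m + 1) → DataGroup 𝓧 𝓨,
        {z : DataGroup 𝓧 𝓨 | 2 ≤ z.1}.indicator (1 : DataGroup 𝓧 𝓨 → ENNReal) (Z l)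
          ∂Measure.pi (fun _ => μ) = μ {z | 2 ≤ z.1} := fun l => by
      rw [(measurePreserving_eval (fun _ => μ) l).lintegral_comp h4,
        lintegral_indicator_one measurableSet_two_le_size]
    rw [lintegral_finsetSum _ fun l _ => h6 l]
    simp [h5]
  -- All `m + 1` groups contribute equally, so the pointwise bound on the sum is integrated and the
  -- factor `m + 1` cancelled.
  have h3 : ((m + 1 : ℕ) : ENNReal) * ∫⁻ Z, extremeMean A a Z k ∂Measure.pi (fun _ => μ) ≤
      ((m + 1 : ℕ) : ENNReal) * (a * μ {z | 2 ≤ z.1}) := by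
    calc _ = ∑ l, ∫⁻ Z, extremeMean A a Z l ∂Measure.pi (fun _ => μ) := by simp [h1]
      _ = ∫⁻ Z, ∑ l, extremeMean A a Z l ∂Measure.pi (fun _ => μ) :=
        (lintegral_finsetSum _ fun l _ => hJ l).symm
      _ ≤ ∫⁻ Z, a * numGroupsTwo Z ∂Measure.pi (fun _ : Fin (m + 1) => μ) :=
        lintegral_mono fun Z => sum_extremeMean_le A a Z
      _ = a * (((m + 1 : ℕ) : ENNReal) * μ {z | 2 ≤ z.1}) := by
        rw [lintegral_const_mul _ hN, h2]
      _ = _ := mul_left_comm _ _ _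
  exact (ENNReal.mul_le_mul_iff_right (by simp) (ENNReal.natCast_ne_top _)).1 h3

theorem lintegral_lintegral_snoc (μ : Measure (DataGroup 𝓧 𝓨)) [IsProbabilityMeasure μ]
    {f : (Fin (m + 1) → DataGroup 𝓧 𝓨) → ENNReal} (hf : Measurable f) :
    ∫⁻ D, ∫⁻ z, f (Fin.snoc (α := fun _ => DataGroup 𝓧 𝓨) D z) ∂μ
      ∂Measure.pi (fun _ : Fin m => μ) = ∫⁻ Z, f Z ∂Measure.pi (fun _ => μ) := by
  have h := (measurePreserving_piFinSuccAbove (fun _ : Fin (m + 1) => μ) (Fin.last m)).symm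
  rw [← h.lintegral_comp hf, lintegral_prod_symm]
  · simp [MeasurableEquiv.piFinSuccAbove, Fin.insertNthEquiv, Fin.insertNth_last']
  · exact (hf.comp h.measurable).aemeasurable

/-- Within a group of size at least two, the pair of the first two entries is as likely to be
extreme as an average pair. -/
theorem lintegral_pairExtreme_eq_lintegral_extremeMean (PY : Kernel 𝓧 𝓨) [IsMarkovKernel PY]
    {A : (Fin (m + 1) → DataGroup 𝓧 𝓨) → 𝓧 × 𝓨 → ℝ} (hA_meas : Measurable (Function.uncurry A))
    (hA : IsHierarchicallySymmetric A) (a : ENNReal) (D : Fin m → DataGroup 𝓧 𝓨) (x : 𝓧)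
    {n : ℕ+} (hn : 2 ≤ n) :
    ∫⁻ z, pairExtreme A a (Fin.snoc (α := fun _ => DataGroup 𝓧 𝓨) D z) (Fin.last m) 0 1
      ∂groupKernel PY (x, n) =
    ∫⁻ z, extremeMean A a (Fin.snoc (α := fun _ => DataGroup 𝓧 𝓨) D z) (Fin.last m)
      ∂groupKernel PY (x, n) := by
  have hs : Measurable fun z => Fin.snoc (α := fun _ => DataGroup 𝓧 𝓨) D z :=
    measurable_snoc.comp measurable_prodMk_left
  have hr : Measurable fun y => DataGroup.ofResponses n x y :=
    (measurable_group_ofResponses (𝓧 := 𝓧) (𝓨 := 𝓨) n).comp measurable_prodMk_left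
  have hH : Measurable fun z =>
      pairExtreme A a (Fin.snoc (α := fun _ => DataGroup 𝓧 𝓨) D z) (Fin.last m) 0 1 :=
    (measurable_pairExtreme hA_meas a _ _ _).comp hs
  have hJ : Measurable fun z =>
      extremeMean A a (Fin.snoc (α := fun _ => DataGroup 𝓧 𝓨) D z) (Fin.last m) :=
    (measurable_extremeMean hA_meas a _).comp hs
  rw [lintegral_groupKernel _ _ _ hH, lintegral_groupKernel _ _ _ hJ]
  have hn' : 1 < (n : ℕ) := by exact_mod_cast hn
  have key := lintegral_pi_eq_lintegral_pairMean (PY x)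
    (fun (y : Fin (n : ℕ) → 𝓨) i j => pairExtreme A a
      (Fin.snoc (α := fun _ => DataGroup 𝓧 𝓨) D (.ofResponses n x y)) (Fin.last m) i j)
    (fun i j => (measurable_pairExtreme hA_meas a _ _ _).comp (hs.comp hr)) ?_
    (a := ⟨0, n.pos⟩) (b := ⟨1, hn'⟩) (by simp)
  · rw [key]
    refine lintegral_congr fun y => ?_
    unfold extremeMean
    rw [Fin.snoc_last]
    rfl
  · intro y σ i j
    have hp : A (Fin.snoc (α := fun _ => DataGroup 𝓧 𝓨) D (.ofResponses n x (y ∘ σ))) =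
        A (Fin.snoc (α := fun _ => DataGroup 𝓧 𝓨) D (.ofResponses n x y)) :=
      hA.snoc_permute D (.ofResponses n x y) σ
    have hp' : ∀ s v, extremeIndicator s a
        (Fin.snoc (α := fun _ => DataGroup 𝓧 𝓨) D (.ofResponses n x (y ∘ σ))) v =
        extremeIndicator s a
          (Fin.snoc (α := fun _ => DataGroup 𝓧 𝓨) D (.ofResponses n x y)) v := fun s v =>
      extremeIndicator_snoc_permute s a D (.ofResponses n x y) σ v
    have he : ∀ (y : Fin (n : ℕ) → 𝓨) (i : Fin (n : ℕ)),
        (DataGroup.ofResponses n x y).entry i = (x, y i) := fun y i =>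
      DataGroup.entry_val (.ofResponses n x y) i
    simp only [pairExtreme, Fin.snoc_last, he]
    rw [hp, hp']
    rfl

/-- Independence makes the square the mass of a product set that constrains only two coordinates,
and on that set the pair is extreme. -/
theorem miscoverage_sq_le_lintegral (PY : Kernel 𝓧 𝓨) [IsMarkovKernel PY] {α : ℝ}
    (hα : α ∈ Set.Icc (0 : ℝ) 1) {A : (Fin (m + 1) → DataGroup 𝓧 𝓨) → 𝓧 × 𝓨 → ℝ}
    (hA_meas : Measurable (Function.uncurry A)) (hA : IsHierarchicallySymmetric A)
    (D : Fin m → DataGroup 𝓧 𝓨) (x : 𝓧) {n : ℕ+} (hn : 2 ≤ n) :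
    miscoverage PY A α D x ^ 2 ≤
      ∫⁻ z, pairExtreme A (ENNReal.ofReal (α ^ 2))
        (Fin.snoc (α := fun _ => DataGroup 𝓧 𝓨) D z) (Fin.last m) 0 1
          ∂groupKernel PY (x, n) := by
  have hs : Measurable fun z => Fin.snoc (α := fun _ => DataGroup 𝓧 𝓨) D z :=
    measurable_snoc.comp measurable_prodMk_left
  have hr : Measurable fun y => DataGroup.ofResponses n x y :=
    (measurable_group_ofResponses (𝓧 := 𝓧) (𝓨 := 𝓨) n).comp measurable_prodMk_left
  have hmeas : Measurable fun z => pairExtreme A (ENNReal.ofReal (α ^ 2))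
      (Fin.snoc (α := fun _ => DataGroup 𝓧 𝓨) D z) (Fin.last m) 0 1 :=
    (measurable_pairExtreme hA_meas (ENNReal.ofReal (α ^ 2)) (Fin.last m) 0 1).comp hs
  have hn' : 1 < (n : ℕ) := by exact_mod_cast hn
  let i₀ : Fin (n : ℕ) := ⟨0, n.pos⟩
  let i₁ : Fin (n : ℕ) := ⟨1, hn'⟩
  have h01 : i₀ ≠ i₁ := by simp [i₀, i₁]
  set B := (predictionSet A α D x)ᶜ with hB
  have h1 : Measure.pi (fun _ : Fin (n : ℕ) => PY x) (Set.univ.pi fun i =>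
      if i ∈ ({i₀, i₁} : Finset (Fin (n : ℕ))) then B else Set.univ) =
        miscoverage PY A α D x ^ 2 := by
    -- The product formula needs no measurability of the factors, so it covers outer probabilities.
    rw [Measure.pi_pi]
    simp only [apply_ite (PY x), measure_univ]
    rw [Finset.prod_ite_mem, Finset.univ_inter, Finset.prod_pair h01, ← sq]
    rfl
  rw [lintegral_groupKernel _ _ _ hmeas, ← h1]
  -- Markov's inequality at level `1`: only the integrand has to be measurable, not the product set.
  refine le_trans (measure_mono fun y hy => ?_) ((one_mul _).symm.trans_le
    (mul_meas_ge_le_lintegral (hmeas.comp hr) 1))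
  have hy0 : y i₀ ∉ predictionSet A α D x := by simpa [hB] using hy i₀ trivial
  have hy1 : y i₁ ∉ predictionSet A α D x := by simpa [hB] using hy i₁ trivial
  refine (extremeIndicator_eq_one_of_notMem_predictionSet hα hA D x hn y i₀ i₁ hy0 hy1).ge.trans
    (le_of_eq ?_)
  have he : ∀ i : Fin (n : ℕ), (DataGroup.ofResponses n x y).entry i = (x, y i) := fun i =>
    DataGroup.entry_val (.ofResponses n x y) i
  simp only [Function.comp_apply, pairExtreme, Fin.snoc_last]
  rw [← he i₀, ← he i₁]
  rfl

theorem measurable_iInf_lintegral_groupKernel {Ω : Type*} [MeasurableSpace Ω] (PY : Kernel 𝓧 𝓨)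
    [IsMarkovKernel PY] {H : Ω → DataGroup 𝓧 𝓨 → ENNReal}
    (hH : Measurable (Function.uncurry H)) :
    Measurable fun p : Ω × 𝓧 =>
      ⨅ n : {n : ℕ+ // 2 ≤ n}, ∫⁻ z, H p.1 z ∂groupKernel PY (p.2, n.1) := by
  refine Measurable.iInf fun n => ?_
  have hq : Measurable fun p : Ω × 𝓧 => (p.2, n.1) := by fun_prop
  have hH' : Measurable (Function.uncurry fun (p : Ω × 𝓧) z => H p.1 z) :=
    hH.comp ((measurable_fst.comp measurable_fst).prodMk measurable_snd)
  exact Measurable.lintegral_kernel_prod_right (κ := (groupKernel PY).comap _ hq) hH'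

/-- Conditioning is restriction to `N ≥ 2` followed by normalisation. The infimum is bounded by its
term at the drawn size, and the restriction is then dropped because `J` is nonnegative. -/
theorem lintegral_iInf_groupKernel_le (PX : Measure 𝓧) [IsProbabilityMeasure PX]
    (PN : Kernel 𝓧 ℕ+) [IsMarkovKernel PN] (PY : Kernel 𝓧 𝓨) [IsMarkovKernel PY]
    {H J : DataGroup 𝓧 𝓨 → ENNReal} (hH : Measurable H) (hJ : Measurable J)
    (hle : ∀ x (n : ℕ+), 2 ≤ n →
      ∫⁻ z, H z ∂groupKernel PY (x, n) ≤ ∫⁻ z, J z ∂groupKernel PY (x, n)) :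
    ∫⁻ x, ⨅ n : {n : ℕ+ // 2 ≤ n}, ∫⁻ z, H z ∂groupKernel PY (x, n.1) ∂featureLawTwo PX PN ≤
      ((PX ⊗ₘ PN) {p : 𝓧 × ℕ+ | 2 ≤ p.2})⁻¹ * ∫⁻ z, J z ∂groupLaw PX PN PY := by
  have hg : Measurable fun x : 𝓧 =>
      ⨅ n : {n : ℕ+ // 2 ≤ n}, ∫⁻ z, H z ∂groupKernel PY (x, n.1) :=
    (measurable_iInf_lintegral_groupKernel PY (H := fun _ : Unit => H)
      (hH.comp measurable_snd)).comp (measurable_prodMk_left (x := ()))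
  rw [featureLawTwo, lintegral_map hg measurable_fst, ProbabilityTheory.cond,
    lintegral_smul_measure, smul_eq_mul, lintegral_groupLaw _ _ _ hJ]
  refine mul_le_mul_right (le_trans (setLIntegral_mono' measurableSet_two_le_snd fun p hp => ?_)
    (setLIntegral_le_lintegral _ _)) _
  exact (iInf_le _ ⟨p.2, hp⟩).trans (hle p.1 p.2 hp)

end

/-! ### The main bound -/

theorem theorem4 {𝓧 𝓨 : Type*} [MeasurableSpace 𝓧] [MeasurableSpace 𝓨]
    (PX : Measure 𝓧) [IsProbabilityMeasure PX]
    (PN : Kernel 𝓧 ℕ+) [IsMarkovKernel PN]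
    (PY : Kernel 𝓧 𝓨) [IsMarkovKernel PY]
    (hN : 0 < (PX ⊗ₘ PN) {p : 𝓧 × ℕ+ | 2 ≤ p.2})
    (K : ℕ) (α : ℝ) (hα : α ∈ Set.Icc (0 : ℝ) 1)
    (A : (Fin (K + 1) → DataGroup 𝓧 𝓨) → 𝓧 × 𝓨 → ℝ)
    (hA_meas : Measurable (Function.uncurry A))
    (hA : IsHierarchicallySymmetric A) :
    upperExpectation ((trainingLaw K PX PN PY).prod (featureLawTwo PX PN))
      (fun p => miscoverage PY A α p.1 p.2 ^ 2) ≤ ENNReal.ofReal (α ^ 2) := by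
  set a := ENNReal.ofReal (α ^ 2) with ha
  let H : (Fin K → DataGroup 𝓧 𝓨) → DataGroup 𝓧 𝓨 → ENNReal := fun D z =>
    pairExtreme A a (Fin.snoc (α := fun _ => DataGroup 𝓧 𝓨) D z) (Fin.last K) 0 1
  have hH : Measurable (Function.uncurry H) :=
    (measurable_pairExtreme hA_meas a (Fin.last K) 0 1).comp measurable_snoc
  let J : (Fin K → DataGroup 𝓧 𝓨) → DataGroup 𝓧 𝓨 → ENNReal := fun D z =>
    extremeMean A a (Fin.snoc (α := fun _ => DataGroup 𝓧 𝓨) D z) (Fin.last K)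
  have hJ : Measurable (Function.uncurry J) :=
    (measurable_extremeMean hA_meas a (Fin.last K)).comp measurable_snoc
  -- The measurable majorant that bounds the upper expectation; the infimum removes the dependence
  -- on the test group size.
  let g : (Fin K → DataGroup 𝓧 𝓨) × 𝓧 → ENNReal := fun p =>
    ⨅ n : {n : ℕ+ // 2 ≤ n}, ∫⁻ z, H p.1 z ∂groupKernel PY (p.2, n.1)
  have hg : Measurable g := measurable_iInf_lintegral_groupKernel PY hH
  have hgle : (fun p : (Fin K → DataGroup 𝓧 𝓨) × 𝓧 => miscoverage PY A α p.1 p.2 ^ 2) ≤ g :=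
    fun p => le_iInf fun n => miscoverage_sq_le_lintegral PY hα hA_meas hA p.1 p.2 n.2
  set c := (PX ⊗ₘ PN) {p : 𝓧 × ℕ+ | 2 ≤ p.2} with hc
  have : SFinite (featureLawTwo PX PN) := by
    unfold featureLawTwo
    infer_instance
  have hinner : ∀ D, ∫⁻ x, g (D, x) ∂featureLawTwo PX PN ≤
      c⁻¹ * ∫⁻ z, J D z ∂groupLaw PX PN PY := fun D =>
    lintegral_iInf_groupKernel_le PX PN PY hH.of_uncurry_left hJ.of_uncurry_left
      fun x n hn => (lintegral_pairExtreme_eq_lintegral_extremeMean PY hA_meas hA a D x hn).le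
  have hJD : Measurable fun D => ∫⁻ z, J D z ∂groupLaw PX PN PY := hJ.lintegral_prod_right'
  refine (iInf₂_le_of_le g hg (iInf_le _ hgle)).trans ?_
  calc ∫⁻ p, g p ∂(trainingLaw K PX PN PY).prod (featureLawTwo PX PN)
      = ∫⁻ D, ∫⁻ x, g (D, x) ∂featureLawTwo PX PN ∂trainingLaw K PX PN PY :=
        lintegral_prod _ hg.aemeasurable
    _ ≤ ∫⁻ D, c⁻¹ * ∫⁻ z, J D z ∂groupLaw PX PN PY ∂trainingLaw K PX PN PY :=
        lintegral_mono hinner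
    _ = c⁻¹ * ∫⁻ D, ∫⁻ z, J D z ∂groupLaw PX PN PY ∂trainingLaw K PX PN PY :=
        lintegral_const_mul _ hJD
    _ = c⁻¹ * ∫⁻ Z, extremeMean A a Z (Fin.last K)
          ∂Measure.pi (fun _ => groupLaw PX PN PY) := by
        -- The unconditioned test group has the law of a training group, so together they form `K +
        -- 1` i.i.d. groups.
        rw [← lintegral_lintegral_snoc _ (measurable_extremeMean hA_meas a _)]
        rfl
    _ ≤ c⁻¹ * (a * c) := by
        refine mul_le_mul_right ((lintegral_extremeMean_le _ hA_meas hA a _).trans_eq ?_) _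
        rw [groupLaw_two_le_size]
    _ = a := by
        rw [mul_comm a, ← mul_assoc, ENNReal.inv_mul_cancel hN.ne' (measure_ne_top _ _), one_mul]
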